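/- For a topological group $H$ and $g,h\in H$, say that $(g,h)$ cyclically generates $H$ if $\{g^l h g^{-l} : l\in\mathbb Z\}$ is dense in $H$. Let $M$ be a nonempty countable first-order structure (in an arbitrary language) that is ultrahomogeneous: every embedding of a finitely generated substructure of $M$ into $M$ extends to an automorphism of $M$. Let $G=\mathrm{Aut}(M)$ with the topology of pointwise convergence ($M$ being discrete). A partial automorphism of $M$ is an isomorphism between finitely generated substructures of $M$. (If $M$ is relational, or merely locally finite, "finitely generated" means "finite".) Let $(X,\mu)$ be a standard Borel space with a non-atomic probability measure, and let $L_0(G)$ be the group of $\mu$-equivalence classes of measurable functions $X\to G$, with pointwise multiplication and the topology of convergence in measure, in which the sets $\{f : \mu\{x : d(f(x),h(x))<\delta\}>1-\varepsilon\}$, $\delta,\varepsilon>0$, form a neighbourhood basis at $h$, where $d$ is a fixed compatible complete metric on $G$. For $g\in G$ let $f_g\in L_0(G)$ be the constant function with value $g$. Suppose that $g\in G$ is such that for every $n$ and all partial automorphisms $\phi_i\colon A_i\to B_i$ and $\psi_i\colon C_i\to D_i$ ($i\le n$) of $M$ there are $k,m\in\mathbb Z$ such that, for each $i\le n$, $g^{k}\phi_i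 g^{-k}\cup g^{m}\psi_i g^{-m}$ extends to a single automorphism of $M$. Then: (1) for every $n\ge 1$ there is $\bar b\in G^n$ such that $((g,\dots,g),\bar b)$ cyclically generates $G^n$, and there is $b\in L_0(G)$ such that $(f_g,b)$ cyclically generates $L_0(G)$. (2) Suppose moreover that $M$ has no algebraicity, i.e. for all disjoint finite sets $A,B\subseteq M$ with $B\neq\emptyset$ the orbit of $B$ under the pointwise stabilizer of $A$ in $G$ is infinite, and that $g$ has no cycles, i.e. $g^n(x)\ne x$ for all $x\in M$ and $n>1$. Then for every $n\ge1$ one can choose $\bar b\in G^n$ such that, in addition, $(g,\dots,g)$ and $\bar b$ freely generate a free group of rank $2$; likewise one can choose $b\in L_0(G)$ such that, in addition, $f_g$ and $b$ freely generate a free group of rank $2$. -/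

import Mathlib

open FirstOrder Topology MeasureTheory

/-! ### The automorphism group as a Polish group -/

section AutGroup

variable {L : Language} {M : Type*} [L.Structure M]

/-- The automorphisms of a structure form a group under composition. -/
instance autGroup : Group (M ≃[L] M) where
  mul f g := f.comp g
  one := Language.Equiv.refl L M
  inv f := f.symm
  mul_assoc _ _ _ := rfl
  one_mul _ := rfl
  mul_one _ := rfl
  inv_mul_cancel f := Language.Equiv.ext fun x => f.symm_apply_apply x

theorem aut_mul_apply (f g : M ≃[L] M) (x : M) : (f * g) x = f (g x) := rfl

theorem aut_one_apply (x : M) : (1 : M ≃[L] M) x = x := rfl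

theorem aut_inv_apply (f : M ≃[L] M) (x : M) : f⁻¹ x = f.symm x := rfl

/-- The topology of pointwise convergence on the automorphism group, the structure itself being
discrete: the coarsest topology for which every set `{f | f x = y}` is open. -/
instance autTopology : TopologicalSpace (M ≃[L] M) :=
  TopologicalSpace.induced (fun f : M ≃[L] M => (f : M → M))
    (@Pi.topologicalSpace M (fun _ => M) fun _ => ⊥)

theorem isOpen_aut_eval (x y : M) : IsOpen {f : M ≃[L] M | f x = y} := by
  let _ : TopologicalSpace M := ⊥
  have : DiscreteTopology M := ⟨rfl⟩
  have h : Continuous (fun f : M ≃[L] M => (f : M → M)) := continuous_induced_dom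
  exact (isOpen_discrete ({y} : Set M)).preimage ((continuous_apply x).comp h)

theorem continuous_to_aut {T : Type*} [TopologicalSpace T] (F : T → (M ≃[L] M))
    (h : ∀ x y, IsOpen {t | F t x = y}) : Continuous F := by
  let _ : TopologicalSpace M := ⊥
  have : DiscreteTopology M := ⟨rfl⟩
  refine continuous_induced_rng.2 (continuous_pi fun x => ?_)
  refine continuous_discrete_rng.2 fun y => ?_
  exact h x y

instance autIsTopologicalGroup : IsTopologicalGroup (M ≃[L] M) where
  continuous_mul := by
    refine continuous_to_aut _ fun x y => ?_
    have : {t : (M ≃[L] M) × (M ≃[L] M) | (t.1 * t.2) x = y}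
        = ⋃ z : M, {f : M ≃[L] M | f z = y} ×ˢ {g : M ≃[L] M | g x = z} := by
      ext t
      simp [aut_mul_apply]
    rw [this]
    exact isOpen_iUnion fun z => (isOpen_aut_eval z y).prod (isOpen_aut_eval x z)
  continuous_inv := by
    refine continuous_to_aut _ fun x y => ?_
    have : {f : M ≃[L] M | f⁻¹ x = y} = {f : M ≃[L] M | f y = x} := by
      ext f
      simp only [Set.mem_ofPred_eq, aut_inv_apply]
      constructor
      · rintro rfl
        exact f.apply_symm_apply x
      · rintro rfl
        exact f.symm_apply_apply y
    rw [this]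
    exact isOpen_aut_eval y x

/-- The automorphism group of a countable structure is Polish. -/
instance autPolishSpace [Countable M] : PolishSpace (M ≃[L] M) := by
  let _ : TopologicalSpace M := ⊥
  have : DiscreteTopology M := ⟨rfl⟩
  have hc : Continuous (fun f : M ≃[L] M => (f : M → M)) := continuous_induced_dom
  let e : (M ≃[L] M) → (M → M) × (M → M) := fun f => (f, (f⁻¹ : M ≃[L] M))
  have he : Continuous e := hc.prodMk (hc.comp continuous_inv)
  have hi : IsInducing e := by
    refine ⟨le_antisymm he.le_induced ?_⟩
    have h1 : (fun f : M ≃[L] M => (f : M → M)) = Prod.fst ∘ e := rfl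
    change TopologicalSpace.induced e _ ≤
      TopologicalSpace.induced (fun f : M ≃[L] M => (f : M → M)) _
    rw [h1, ← induced_compose]
    exact induced_mono continuous_fst.le_induced
  have hinj : Function.Injective e := fun f g h =>
    Language.Equiv.coe_injective (congrArg Prod.fst h)
  have hev (x y : M) : IsClopen {p : (M → M) × (M → M) | p.1 x = y} :=
    (isClopen_discrete ({y} : Set M)).preimage ((continuous_apply x).comp continuous_fst)
  have hrange : Set.range e = {p : (M → M) × (M → M) |
      (∀ x, p.2 (p.1 x) = x) ∧ (∀ x, p.1 (p.2 x) = x) ∧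
      (∀ (n : ℕ) (f : L.Functions n) (x : Fin n → M),
        p.1 (Language.Structure.funMap f x) = Language.Structure.funMap f (p.1 ∘ x)) ∧
      (∀ (n : ℕ) (r : L.Relations n) (x : Fin n → M),
        Language.Structure.RelMap r (p.1 ∘ x) ↔ Language.Structure.RelMap r x)} := by
    ext p
    constructor
    · rintro ⟨f, rfl⟩
      exact ⟨fun x => f.symm_apply_apply x, fun x => f.apply_symm_apply x,
        fun n k x => f.map_fun k x, fun n r x => f.map_rel r x⟩
    · rintro ⟨h1, h2, h3, h4⟩
      exact ⟨{ toFun := p.1, invFun := p.2, left_inv := h1, right_inv := h2,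
               map_fun' := fun k x => h3 _ k x, map_rel' := fun r x => h4 _ r x }, rfl⟩
  have hclosed : IsClosed (Set.range e) := by
    rw [hrange]
    have c1 (x : M) : Continuous fun p : (M → M) × (M → M) => p.1 x :=
      (continuous_apply x).comp continuous_fst
    have c2 (x : M) : Continuous fun p : (M → M) × (M → M) => p.2 x :=
      (continuous_apply x).comp continuous_snd
    have ev : Continuous fun q : (M → M) × M => q.1 q.2 := by
      refine continuous_discrete_rng.2 fun y => ?_
      have : (fun q : (M → M) × M => q.1 q.2) ⁻¹' {y}
          = ⋃ z : M, {f : M → M | f z = y} ×ˢ {z} := by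
        ext q
        simp
      rw [this]
      refine isOpen_iUnion fun z => IsOpen.prod ?_ (isOpen_discrete _)
      exact (isOpen_discrete ({y} : Set M)).preimage
        (continuous_apply z : Continuous fun f : M → M => f z)
    have cc {n : ℕ} (x : Fin n → M) : Continuous fun p : (M → M) × (M → M) => p.1 ∘ x :=
      continuous_pi fun i => c1 (x i)
    simp only [Set.ofPred_and, Set.ofPred_forall]
    refine IsClosed.inter ?_ (IsClosed.inter ?_ (IsClosed.inter ?_ ?_))
    · exact isClosed_iInter fun x =>
        isClosed_eq (ev.comp (continuous_snd.prodMk (c1 x))) continuous_const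
    · exact isClosed_iInter fun x =>
        isClosed_eq (ev.comp (continuous_fst.prodMk (c2 x))) continuous_const
    · refine isClosed_iInter fun n => isClosed_iInter fun f => isClosed_iInter fun x => ?_
      exact isClosed_eq (c1 _) (continuous_of_discreteTopology.comp (cc x))
    · refine isClosed_iInter fun n => isClosed_iInter fun r => isClosed_iInter fun x => ?_
      exact (isClosed_discrete {y : Fin n → M | Language.Structure.RelMap r y ↔
        Language.Structure.RelMap r x}).preimage (cc x)
  have : Countable M := ‹_›
  have : PolishSpace M := inferInstance
  have : PolishSpace (M → M) := inferInstance
  have : PolishSpace ((M → M) × (M → M)) := inferInstance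
  exact (Topology.IsClosedEmbedding.mk ⟨hi, hinj⟩ hclosed).polishSpace

end AutGroup

/-! ### Groups of measurable functions -/

section LZero

/-- `LZero μ Y`: the measurable functions with values in `Y`, modulo `μ`-almost everywhere equality.
For a Polish group `Y` it is a group under pointwise multiplication. (For a Polish space `Y`,
a.e. strongly measurable functions are the functions a.e. equal to a Borel function.) -/
abbrev LZero {X : Type*} [MeasurableSpace X] (μ : Measure X) (Y : Type*) [TopologicalSpace Y] :=
  X →ₘ[μ] Y

variable {X : Type*} [MeasurableSpace X] {μ : Measure X} {Y : Type*} [TopologicalSpace Y]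

/-- The set `[h, δ, ε] = {f | μ {x | d (f x, h x) < δ} > 1 - ε}`, where `d` is a fixed compatible
complete metric on `Y`. -/
def LZero.nbhd [TopologicalSpace.IsCompletelyMetrizableSpace Y] (h : LZero μ Y) (δ ε : ℝ) : Set (LZero μ Y) :=
  letI := TopologicalSpace.upgradeIsCompletelyMetrizable Y
  {f | 1 - ε < μ.real {x | dist (f x) (h x) < δ}}

theorem LZero.nbhd_mono [TopologicalSpace.IsCompletelyMetrizableSpace Y] [IsFiniteMeasure μ] (h : LZero μ Y)
    {δ δ' ε ε' : ℝ} (hδ : δ ≤ δ') (hε : ε ≤ ε') : LZero.nbhd h δ ε ⊆ LZero.nbhd h δ' ε' := by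
  letI := TopologicalSpace.upgradeIsCompletelyMetrizable Y
  intro f hf
  have h1 : 1 - ε < μ.real {x | dist (f x) (h x) < δ} := hf
  have h2 : μ.real {x | dist (f x) (h x) < δ} ≤ μ.real {x | dist (f x) (h x) < δ'} :=
    measureReal_mono fun x hx => lt_of_lt_of_le hx hδ
  change 1 - ε' < μ.real {x | dist (f x) (h x) < δ'}
  linarith

/-- The topology of convergence in measure: the sets `[h, δ, ε]`, `δ, ε > 0`, form a neighbourhood
basis at `h`. -/
instance LZero.topology [TopologicalSpace.IsCompletelyMetrizableSpace Y] [IsProbabilityMeasure μ] :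
    TopologicalSpace (LZero μ Y) where
  IsOpen U := ∀ h ∈ U, ∃ δ > 0, ∃ ε > 0, LZero.nbhd h δ ε ⊆ U
  isOpen_univ := fun _ _ => ⟨1, one_pos, 1, one_pos, Set.subset_univ _⟩
  isOpen_inter := by
    rintro U V hU hV h ⟨hhU, hhV⟩
    obtain ⟨δ, hδ, ε, hε, hs⟩ := hU h hhU
    obtain ⟨δ', hδ', ε', hε', hs'⟩ := hV h hhV
    exact ⟨min δ δ', lt_min hδ hδ', min ε ε', lt_min hε hε', Set.subset_inter
      ((LZero.nbhd_mono h (min_le_left _ _) (min_le_left _ _)).trans hs)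
      ((LZero.nbhd_mono h (min_le_right _ _) (min_le_right _ _)).trans hs')⟩
  isOpen_sUnion := by
    rintro S hS h ⟨U, hU, hhU⟩
    obtain ⟨δ, hδ, ε, hε, hs⟩ := hS U hU h hhU
    exact ⟨δ, hδ, ε, hε, hs.trans (Set.subset_sUnion_of_mem hU)⟩

end LZero

/-! ### Generation -/

/-- `(g, h)` cyclically generates `H`: the set `{g ^ l * h * g ^ (-l) | l ∈ ℤ}` is dense. -/
def CyclicallyGenerates {H : Type*} [Group H] [TopologicalSpace H] (g h : H) : Prop :=
  Dense (Set.range fun l : ℤ => g ^ l * h * g ^ (-l))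

/-- `g` and `h` freely generate a free group of rank two: no nontrivial reduced word in two letters
vanishes at `(g, h)`. -/
def GenerateFreeGroup {H : Type*} [Group H] (g h : H) : Prop :=
  Function.Injective (FreeGroup.lift ![g, h] : FreeGroup (Fin 2) →* H)

/-! ### Model-theoretic notions -/

section Model

variable {L : Language} {M : Type*} [L.Structure M]

/-- The automorphism `f` extends the conjugate `g ^ k φ g ^ (-k)` of the partial automorphism `φ`,
a map from `g ^ k (dom φ)` to `g ^ k (cod φ)` that sends `g ^ k x` to `g ^ k (φ x)`. -/
def ExtendsConj (f g : M ≃[L] M) (k : ℤ) (φ : L.FGEquiv M M) : Prop :=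
  ∀ x : φ.1.dom, f ((g ^ k) (x : M)) = (g ^ k) (φ.1.toEquiv x : M)

/-- Any finitely many pairs `(φ i, ψ i)` of partial automorphisms (isomorphisms between finitely
generated substructures) can be conjugated by powers of `g`, with exponents `k`, `m` not depending
on `i`, so that for each `i` the union of the two conjugates extends to an automorphism. -/
def ConjugatesAmalgamate (g : M ≃[L] M) : Prop :=
  ∀ (n : ℕ) (φ ψ : Fin n → L.FGEquiv M M), ∃ k m : ℤ, ∀ i : Fin n,
    ∃ f : M ≃[L] M, ExtendsConj f g k (φ i) ∧ ExtendsConj f g m (ψ i)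

variable (L M) in
/-- `M` has no algebraicity: for disjoint finite `A, B ⊆ M` with `B` nonempty, the orbit of `B`
under the pointwise stabilizer of `A` is infinite. (In a relational language the finite subsets are
exactly the finite substructures.) -/
def NoAlgebraicity : Prop :=
  ∀ A B : Set M, A.Finite → B.Finite → B.Nonempty → Disjoint A B →
    {C : Set M | ∃ f : M ≃[L] M, (∀ x ∈ A, f x = x) ∧ f '' B = C}.Infinite

/-- `g` has no cycles. -/
def NoCycles (g : M ≃[L] M) : Prop :=
  ∀ (x : M) (n : ℕ), 1 < n → (g ^ n) x ≠ x

end Model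

/-! The proof is by Baire category. For fixed `g`, the elements `b` whose conjugates by powers of
`g` are dense form the intersection, over a countable base, of the open sets of those `b` with some
conjugate in a given basic set. Each of these sets is dense once conjugation by powers of `g` is
topologically transitive.

For `Aut(M)`, basic open sets prescribe finitely many values, and amalgamating two conjugated
partial automorphisms gives transitivity. The exponents serve finitely many pairs at once
(`ConjugatesAmalgamate.transitive`). This gives `G ^ n` by working coordinatewise and `L₀(G)` by
working with the finitely many values of simple functions. For the latter, convergence in measure is
induced by a complete separable metric.

For freeness, each nontrivial word `w` adds the open condition `w(g, b) ≠ 1`, and there are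
countably many words. Density of these conditions in `G` is a step-by-step construction
(`exists_wordProd_apply_ne`). The trajectory of a point is followed along the word, and each value
of `b` not yet fixed is chosen generically, which no algebraicity permits. Density then passes to `G
^ n` through one coordinate and to `L₀(G)` through simple functions. -/

/-- In a Baire group with a countable base, if conjugation by powers of `g` is topologically
transitive then some element of any given countable intersection of dense open sets has a dense
orbit. -/
theorem exists_cyclicallyGenerates {H : Type*} [Group H] [TopologicalSpace H] [BaireSpace H]
    [SecondCountableTopology H] (g : H)
    (hc : ∀ l : ℤ, Continuous fun b : H => g ^ l * b * g ^ (-l))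
    (ht : ∀ U V : Set H, IsOpen U → IsOpen V → U.Nonempty → V.Nonempty →
      ∃ l : ℤ, ∃ b ∈ U, g ^ l * b * g ^ (-l) ∈ V)
    {ι : Type*} [Countable ι] (D : ι → Set H) (ho : ∀ i, IsOpen (D i)) (hd : ∀ i, Dense (D i)) :
    ∃ b, CyclicallyGenerates g b ∧ ∀ i, b ∈ D i := by
  let B := TopologicalSpace.countableBasis H
  let W : B → Set H := fun V => ⋃ l : ℤ, (fun b : H => g ^ l * b * g ^ (-l)) ⁻¹' V
  have hB := TopologicalSpace.isBasis_countableBasis H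
  have hVo (V : B) : IsOpen (V : Set H) := hB.isOpen V.2
  have hVn (V : B) : (V : Set H).Nonempty := by
    rw [Set.nonempty_iff_ne_empty]
    intro h
    exact TopologicalSpace.empty_notMem_countableBasis H (h ▸ V.2)
  have hWo (V : B) : IsOpen (W V) := isOpen_iUnion fun l => (hVo V).preimage (hc l)
  have hWd (V : B) : Dense (W V) := by
    rw [dense_iff_inter_open]
    intro U hU hUn
    obtain ⟨l, b, hb, hbV⟩ := ht U V hU (hVo V) hUn (hVn V)
    exact ⟨b, hb, Set.mem_iUnion.2 ⟨l, hbV⟩⟩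
  have : Countable B := (TopologicalSpace.countable_countableBasis H).to_subtype
  have hdense : Dense (⋂ j : B ⊕ ι, Sum.elim W D j) :=
    dense_iInter_of_isOpen (by rintro (j | j) <;> simp [hWo, ho])
      (by rintro (j | j) <;> simp [hWd, hd])
  obtain ⟨b, hb⟩ := @Dense.nonempty _ _ _ ⟨(1 : H)⟩ hdense
  rw [Set.mem_iInter] at hb
  refine ⟨b, ?_, fun i => hb (Sum.inr i)⟩
  rw [CyclicallyGenerates, hB.dense_iff]
  intro V hV _
  obtain ⟨l, hl⟩ := Set.mem_iUnion.1 (hb (Sum.inl ⟨V, hV⟩))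
  exact ⟨_, hl, l, rfl⟩

theorem generateFreeGroup_iff {H : Type*} [Group H] (g h : H) :
    GenerateFreeGroup g h ↔
      ∀ w : {w : FreeGroup (Fin 2) // w ≠ 1}, FreeGroup.lift ![g, h] w ≠ 1 := by
  rw [GenerateFreeGroup, injective_iff_map_eq_one]
  exact ⟨fun h w hw => w.2 (h _ hw), fun h w hw => by_contra fun hn => h ⟨w, hn⟩ hw⟩

/-! ### Transitivity and generic words in the automorphism group -/

section Aut

variable {L : Language} {M : Type*} [L.Structure M]

theorem aut_inv_apply_eq (f : M ≃[L] M) {x y : M} : f⁻¹ x = y ↔ x = f y :=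
  f.toEquiv.symm_apply_eq

theorem aut_apply_inv_apply (f : M ≃[L] M) (x : M) : f (f⁻¹ x) = x :=
  f.apply_symm_apply x

theorem exists_finite_of_mem_isOpen {U : Set (M ≃[L] M)} (hU : IsOpen U) {u : M ≃[L] M}
    (hu : u ∈ U) : ∃ A : Set M, A.Finite ∧ ∀ f : M ≃[L] M, (∀ x ∈ A, f x = u x) → f ∈ U := by
  let _ : TopologicalSpace M := ⊥
  have : DiscreteTopology M := ⟨rfl⟩
  obtain ⟨W, hW, rfl⟩ := isOpen_induced_iff.1 hU
  obtain ⟨I, v, hv, hI⟩ := isOpen_pi_iff.1 hW u hu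
  refine ⟨I, I.finite_toSet, fun f hf => hI fun x hx => ?_⟩
  change f x ∈ v x
  rw [hf x hx]
  exact (hv x hx).2

/-- The restriction of an automorphism to the substructure generated by a finite set. -/
noncomputable def restrictFG (u : M ≃[L] M) {A : Set M} (hA : A.Finite) : L.FGEquiv M M :=
  ⟨⟨Language.Substructure.closure L A, (Language.Substructure.closure L A).map u.toEmbedding.toHom,
    u.toEmbedding.substructureEquivMap _⟩, Language.Substructure.fg_closure hA⟩

theorem ExtendsConj.conj_eq {f g u : M ≃[L] M} {k : ℤ} {A : Set M} {hA : A.Finite}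
    (h : ExtendsConj f g k (restrictFG u hA)) {x : M} (hx : x ∈ A) :
    (g ^ (-k) * f * g ^ k) x = u x := by
  have h1 : f ((g ^ k) x) = (g ^ k) (u x) := h ⟨x, Language.Substructure.subset_closure hx⟩
  rw [aut_mul_apply, aut_mul_apply, h1, ← aut_mul_apply, ← zpow_add, neg_add_cancel, zpow_zero]
  rfl

/-- The single exponent `l` for all `i` is what makes this usable in powers of the group and for
simple functions. -/
theorem ConjugatesAmalgamate.transitive {g : M ≃[L] M} (hg : ConjugatesAmalgamate g)
    {ι : Type*} [Finite ι] (U V : ι → Set (M ≃[L] M)) (hU : ∀ i, IsOpen (U i))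
    (hV : ∀ i, IsOpen (V i)) (hUn : ∀ i, (U i).Nonempty) (hVn : ∀ i, (V i).Nonempty) :
    ∃ (l : ℤ) (b : ι → (M ≃[L] M)), ∀ i, b i ∈ U i ∧ g ^ l * b i * g ^ (-l) ∈ V i := by
  choose u hu using hUn
  choose v hv using hVn
  choose A hA hAU using fun i => exists_finite_of_mem_isOpen (hU i) (hu i)
  choose B hB hBV using fun i => exists_finite_of_mem_isOpen (hV i) (hv i)
  obtain ⟨n, ⟨e⟩⟩ := Finite.exists_equiv_fin ι
  obtain ⟨k, m, h⟩ := hg n (fun i => restrictFG (u (e.symm i)) (hA _))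
    (fun i => restrictFG (v (e.symm i)) (hB _))
  have h' (i : ι) : ∃ f : M ≃[L] M, ExtendsConj f g k (restrictFG (u i) (hA i)) ∧
      ExtendsConj f g m (restrictFG (v i) (hB i)) := by
    obtain ⟨j, rfl⟩ := e.symm.surjective i
    exact h j
  choose f hf1 hf2 using h'
  -- Conjugating `f i` back by `g ^ k` recovers `u i` on `A i`; conjugating it back by `g ^ m`
  -- recovers `v i` on `B i`. The two conjugates differ by `g ^ (k - m)`.
  refine ⟨k - m, fun i => g ^ (-k) * f i * g ^ k, fun i => ⟨hAU i _ fun x hx => (hf1 i).conj_eq hx,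
    hBV i _ fun x hx => ?_⟩⟩
  have h1 : g ^ (k - m) * (g ^ (-k) * f i * g ^ k) * g ^ (-(k - m)) = g ^ (-m) * f i * g ^ m := by
    group
  rw [h1]
  exact (hf2 i).conj_eq hx

/-! ### Words in two automorphisms -/

/-- The product of the `b ^ ε * g ^ n` over the entries `(ε, n)` of a list, where `ε = ±1` is coded
by a Boolean. -/
def wordProd {H : Type*} [Group H] (g b : H) : List (Bool × ℤ) → H
  | [] => 1
  | (e, n) :: S => cond e b b⁻¹ * (g ^ n * wordProd g b S)

theorem map_wordProd {H K : Type*} [Group H] [Group K] (φ : H →* K) (g b : H)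
    (S : List (Bool × ℤ)) : φ (wordProd g b S) = wordProd (φ g) (φ b) S := by
  induction S with
  | nil => simp [wordProd]
  | cons p S ih =>
    obtain ⟨e, n⟩ := p
    cases e <;> simp [wordProd, ih]

/-- No cancellation of `b` occurs in `wordProd g b S`. -/
def WordReduced (S : List (Bool × ℤ)) : Prop :=
  S.IsChain fun p q => p.1 ≠ q.1 → p.2 ≠ 0

/-- Normal form for the density argument: syllables in `g` are grouped, so only the letters `b` and
`b⁻¹` remain to be treated one by one. -/
theorem exists_wordProd (w : FreeGroup (Fin 2)) :
    ∃ (m : ℤ) (S : List (Bool × ℤ)), WordReduced S ∧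
      w = FreeGroup.of 0 ^ m * wordProd (FreeGroup.of 0) (FreeGroup.of 1) S := by
  have hw : FreeGroup.lift FreeGroup.of w = w := by rw [FreeGroup.lift_of_eq_id]; rfl
  rw [← hw, ← FreeGroup.mk_toWord (x := w), FreeGroup.lift_mk]
  induction w.toWord with
  | nil => exact ⟨0, [], List.isChain_nil, by simp [wordProd]⟩
  | cons a l ih =>
    obtain ⟨m, S, hS, ih⟩ := ih
    obtain ⟨i, e⟩ := a
    simp only [List.map_cons, List.prod_cons, ih]
    fin_cases i
    · refine ⟨cond e 1 (-1) + m, S, hS, ?_⟩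
      cases e <;> simp [zpow_add, mul_assoc]
    · by_cases hc : WordReduced ((e, m) :: S)
      · exact ⟨0, (e, m) :: S, hc, by simp [wordProd]⟩
      -- The new letter cancels against the head of `S`, which requires `m = 0`; dropping that head
      -- exposes its exponent `n`.
      · cases S with
        | nil => exact absurd (List.isChain_singleton _) hc
        | cons p S =>
          obtain ⟨e', n⟩ := p
          rw [WordReduced, List.isChain_cons_cons, not_and_or] at hc
          have hc := hc.resolve_right (not_not.2 hS)
          push Not at hc
          obtain ⟨h1, rfl⟩ := hc
          refine ⟨n, S, (List.isChain_cons.1 hS).2, ?_⟩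
          revert h1
          cases e <;> cases e' <;> simp [wordProd]

/-- The points at which the value of `b` (if `e` is true) or of `b⁻¹` (if `e` is false) is
determined by the restriction of `b` to `A`. -/
def pinned (e : Bool) (b : M ≃[L] M) (A : Set M) : Set M :=
  cond e A (b '' A)

theorem pinned_finite (e : Bool) (b : M ≃[L] M) {A : Set M} (hA : A.Finite) :
    (pinned e b A).Finite := by
  cases e
  exacts [hA.image _, hA]

theorem NoAlgebraicity.infinite (h : NoAlgebraicity L M) {A : Set M} (hA : A.Finite) {y : M}
    (hy : y ∉ A) : {z : M | ∃ f : M ≃[L] M, (∀ x ∈ A, f x = x) ∧ f y = z}.Infinite := by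
  intro hfin
  refine h A {y} hA (Set.finite_singleton y) (Set.singleton_nonempty y)
    (Set.disjoint_singleton_right.2 hy) ((hfin.image fun z => {z}).subset ?_)
  rintro C ⟨f, hf, rfl⟩
  exact ⟨f y, ⟨f, hf, rfl⟩, by simp⟩

theorem NoAlgebraicity.infinite_structure [Nonempty M] (h : NoAlgebraicity L M) : Infinite M :=
  Set.infinite_univ_iff.1
    ((h.infinite Set.finite_empty (Set.notMem_empty (Classical.arbitrary M))).mono
      (Set.subset_univ _))

theorem NoCycles.zpow_apply_ne {g : M ≃[L] M} (h : NoCycles g) {k : ℤ} (hk : k ≠ 0) (x : M) :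
    (g ^ k) x ≠ x := by
  intro hx
  have hfix (f : M ≃[L] M) (hf : f x = x) : (f ^ 2) x = x := by
    rw [pow_two, aut_mul_apply, hf, hf]
  have h1 : (g ^ k.natAbs) x = x := by
    rcases Int.natAbs_eq k with hn | hn
    · rw [hn, zpow_natCast] at hx
      exact hx
    · rw [hn, zpow_neg, zpow_natCast, aut_inv_apply] at hx
      conv_lhs => rw [← hx]
      exact Language.Equiv.apply_symm_apply _ _
  -- The exponent is doubled because `NoCycles` speaks only of exponents greater than `1`, while
  -- `k.natAbs` may be `1`.
  refine h x (k.natAbs * 2) (by omega) ?_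
  rw [pow_mul]
  exact hfix _ h1

/-- One letter: if the value of `b ^ ε` at `y` is not determined by the restriction of `b` to `A`,
then `b` can be changed off `A` so that this value avoids a given finite set. -/
theorem NoAlgebraicity.exists_extend (h : NoAlgebraicity L M) (b : M ≃[L] M) {A : Set M}
    (hA : A.Finite) (e : Bool) {y : M} (hy : y ∉ pinned e b A) {F : Set M} (hF : F.Finite) :
    ∃ b' : M ≃[L] M, (∀ x ∈ A, b' x = b x) ∧ ∃ z ∉ F, (cond e b' b'⁻¹) y = z := by
  -- `f` fixes the pinned points and sends `y` to `z`, and `b ^ ε` will be replaced by `b ^ ε * f`.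
  -- So `z` has to avoid the preimage of `F` under `b ^ ε`.
  obtain ⟨z, ⟨f, hf, hz⟩, hzF⟩ := ((h.infinite (pinned_finite e b hA) hy).sdiff
    (hF.preimage ((cond e b b⁻¹ : M ≃[L] M).injective.injOn))).nonempty
  cases e
  · refine ⟨f⁻¹ * b, fun x hx => ?_, (b⁻¹ : M ≃[L] M) z, hzF, ?_⟩
    · rw [aut_mul_apply, aut_inv_apply_eq]
      exact (hf _ ⟨x, hx, rfl⟩).symm
    · rw [← hz, ← aut_mul_apply]
      simp
  · exact ⟨b * f, fun x hx => by rw [aut_mul_apply, hf x hx], b z, hzF, by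
      rw [← hz]; rfl⟩

/-- The extra letter `e` is the one to be applied next. Keeping `y` unpinned for it leaves the next
value free, and this is the invariant that drives the induction. The finite set `A` records the
values of `b` already used, so the computed trajectory survives later changes of `b`. -/
theorem exists_wordProd_apply_ne [Nonempty M] (h : NoAlgebraicity L M) {g : M ≃[L] M}
    (hg : NoCycles g) (b₀ : M ≃[L] M) {A₀ : Set M} (hA₀ : A₀.Finite) (S : List (Bool × ℤ))
    (k : ℤ) (e : Bool) (hS : WordReduced ((e, k) :: S)) :
    ∃ (b : M ≃[L] M) (A : Set M) (x y : M), A.Finite ∧ A₀ ⊆ A ∧ (∀ z ∈ A₀, b z = b₀ z) ∧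
      y ∉ pinned e b A ∧ (S ≠ [] → y ≠ x) ∧
      ∀ b' : M ≃[L] M, (∀ z ∈ A, b' z = b z) → (g ^ k * wordProd g b' S) x = y := by
  induction S generalizing k e with
  | nil =>
    have := h.infinite_structure
    obtain ⟨y, hy⟩ := (pinned_finite e b₀ hA₀).exists_notMem
    refine ⟨b₀, A₀, (g ^ (-k)) y, y, hA₀, subset_rfl, fun _ _ => rfl, hy, fun h => absurd rfl h,
      fun b' _ => ?_⟩
    rw [← aut_mul_apply]
    simp [wordProd, aut_one_apply]
  | cons p S ih =>
    obtain ⟨e₁, n⟩ := p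
    obtain ⟨hk, hS⟩ := List.isChain_cons_cons.1 hS
    obtain ⟨b₁, A₁, x, y₁, hA₁, hA, hb₁, hy₁, -, hw⟩ := ih n e₁ hS
    -- Avoiding `x` makes the word move `x`. Avoiding `y₁`, `A₁` and its image keeps the new
    -- endpoint unpinned, except possibly at `z` itself.
    have hF : ((g ^ k : M ≃[L] M) ⁻¹' ({x, y₁} ∪ A₁ ∪ b₁ '' A₁)).Finite :=
      (((Set.toFinite _).union hA₁).union (hA₁.image _)).preimage
        (g ^ k : M ≃[L] M).injective.injOn
    obtain ⟨b, hb, z, hzF, hz⟩ := h.exists_extend b₁ hA₁ e₁ hy₁ hF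
    have himage : b '' A₁ = b₁ '' A₁ := Set.image_congr hb
    simp only [Set.mem_preimage, Set.mem_union, Set.mem_insert_iff, Set.mem_singleton_iff,
      not_or] at hzF
    obtain ⟨⟨⟨hzx, hzy⟩, hzA⟩, hzb⟩ := hzF
    -- The newly used value is `b y₁ = z` if `e₁` is true and `b z = y₁` otherwise; the inserted
    -- point is the argument of `b`.
    refine ⟨b, insert (cond e₁ y₁ z) A₁, x, (g ^ k) z, hA₁.insert _,
      hA.trans (Set.subset_insert _ _), fun t ht => (hb t (hA ht)).trans (hb₁ t ht), ?_,
      fun _ => hzx, fun b' hb' => ?_⟩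
    -- The point `z` is newly pinned for `e` exactly when `e ≠ e₁`. Then reducedness gives `k ≠ 0`,
    -- and `g ^ k` has no fixed point.
    · have hkz : e ≠ e₁ → (g ^ k) z ≠ z := fun h => hg.zpow_apply_ne (hk h) z
      cases e <;> cases e₁ <;>
        simp only [pinned, cond_true, cond_false, Set.image_insert_eq, Set.mem_insert_iff, himage,
          not_or] at hz ⊢
      · have hbz : b z = y₁ := by rw [← hz, aut_apply_inv_apply]
        rw [hbz]
        exact ⟨hzy, hzb⟩
      · rw [hz]
        exact ⟨hkz (by simp), hzb⟩
      · exact ⟨hkz (by simp), hzA⟩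
      · exact ⟨hzy, hzA⟩
    · have h1 : (g ^ n * wordProd g b' S) x = y₁ :=
        hw b' fun t ht => (hb' t (Set.mem_insert_of_mem _ ht)).trans (hb t ht)
      have h2 := hb' _ (Set.mem_insert _ _)
      rw [wordProd, aut_mul_apply, aut_mul_apply, h1]
      congr 1
      cases e₁
      · simp only [cond_false] at hz h2 ⊢
        rw [aut_inv_apply_eq, h2, ← hz, aut_apply_inv_apply]
      · exact h2.trans hz

theorem dense_setOf_lift_ne_one [Nonempty M] (h : NoAlgebraicity L M) {g : M ≃[L] M}
    (hg : NoCycles g) {w : FreeGroup (Fin 2)} (hw : w ≠ 1) :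
    Dense {b : M ≃[L] M | FreeGroup.lift ![g, b] w ≠ 1} := by
  rw [dense_iff_inter_open]
  rintro U hU ⟨b₀, hb₀⟩
  obtain ⟨A₀, hA₀, hAU⟩ := exists_finite_of_mem_isOpen hU hb₀
  obtain ⟨m, S, hS, rfl⟩ := exists_wordProd w
  simp only [map_mul, map_zpow, map_wordProd, FreeGroup.lift_apply_of, Matrix.cons_val_zero,
    Matrix.cons_val_one]
  cases S with
  | nil =>
    refine ⟨b₀, hb₀, fun h1 => ?_⟩
    rw [wordProd, mul_one] at h1
    have hm : m ≠ 0 := by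
      rintro rfl
      exact hw (by simp [wordProd])
    exact hg.zpow_apply_ne hm (Classical.arbitrary M) (by rw [h1]; rfl)
  | cons p S =>
    -- Taking `e = p.1` makes the chain condition at the head vacuous, so `m` may be `0`.
    obtain ⟨b, A, x, y, -, hA, hb, -, hyx, hy⟩ := exists_wordProd_apply_ne h hg b₀ hA₀ (p :: S) m p.1
      (List.isChain_cons_cons.2 ⟨fun h => absurd rfl h, hS⟩)
    refine ⟨b, hAU b hb, fun h1 => hyx (List.cons_ne_nil _ _) ?_⟩
    rw [← hy b fun _ _ => rfl, h1]
    rfl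

theorem continuous_lift {H : Type*} [Group H] [TopologicalSpace H] [IsTopologicalGroup H] (g : H)
    (w : FreeGroup (Fin 2)) : Continuous fun b : H => FreeGroup.lift ![g, b] w := by
  rw [← FreeGroup.mk_toWord (x := w)]
  simp only [FreeGroup.lift_mk]
  induction w.toWord with
  | nil => exact continuous_const
  | cons a l ih =>
    obtain ⟨i, e⟩ := a
    simp only [List.map_cons, List.prod_cons]
    refine Continuous.mul ?_ ih
    fin_cases i <;> cases e <;> simp <;> fun_prop

instance aut_t2Space : T2Space (M ≃[L] M) := by
  let _ : TopologicalSpace M := ⊥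
  have : DiscreteTopology M := ⟨rfl⟩
  have hc : Continuous (fun f : M ≃[L] M => (f : M → M)) := continuous_induced_dom
  exact T2Space.of_injective_continuous Language.Equiv.coe_injective hc

end Aut

/-! ### A complete separable metric for convergence in measure -/

section ConvergenceInMeasure

open ENNReal

variable {X : Type*} [MeasurableSpace X] {μ : Measure X}

/-- The simple functions obtained from constants in `D` by at most `n` rounds of gluing along sets
in `𝒜`. -/
def gluedSimple {Y : Type*} (𝒜 : Set {s : Set X // MeasurableSet s}) (D : Set Y) :
    ℕ → Set (SimpleFunc X Y)
  | 0 => SimpleFunc.const X '' D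
  | n + 1 => gluedSimple 𝒜 D n ∪
      ⋃ s ∈ 𝒜, Set.image2 (fun f g => f.piecewise s.1 s.2 g) (gluedSimple 𝒜 D n) (gluedSimple 𝒜 D n)

theorem gluedSimple_countable {Y : Type*} {𝒜 : Set {s : Set X // MeasurableSet s}} (h𝒜 : 𝒜.Countable)
    {D : Set Y} (hD : D.Countable) (n : ℕ) : (gluedSimple 𝒜 D n).Countable := by
  induction n with
  | zero => exact hD.image _
  | succ n ih => exact ih.union (h𝒜.biUnion fun s _ => ih.image2 ih _)

theorem gluedSimple_mono {Y : Type*} (𝒜 : Set {s : Set X // MeasurableSet s}) (D : Set Y) :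
    Monotone (gluedSimple 𝒜 D) :=
  monotone_nat_of_le_succ fun _ => Set.subset_union_left

section Metric

variable {Y : Type*} [MetricSpace Y]

/-- The distance `∫ min (1, d (f x, h x))`, which induces convergence in measure. -/
noncomputable def edistInMeasure (f h : X →ₘ[μ] Y) : ℝ≥0∞ :=
  ∫⁻ x, min 1 (edist (f x) (h x)) ∂μ

theorem aemeasurable_edist_coeFn (f h : X →ₘ[μ] Y) :
    AEMeasurable (fun x => edist (f x) (h x)) μ :=
  (continuous_edist.comp_aestronglyMeasurable₂ f.aestronglyMeasurable
    h.aestronglyMeasurable).aemeasurable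

theorem aemeasurable_min_edist (f h : X →ₘ[μ] Y) :
    AEMeasurable (fun x => min 1 (edist (f x) (h x))) μ :=
  aemeasurable_const.min (aemeasurable_edist_coeFn f h)

theorem edistInMeasure_eq {f h : X →ₘ[μ] Y} {f' h' : X → Y} (hf : f =ᵐ[μ] f') (hh : h =ᵐ[μ] h') :
    edistInMeasure f h = ∫⁻ x, min 1 (edist (f' x) (h' x)) ∂μ := by
  refine lintegral_congr_ae ?_
  filter_upwards [hf, hh] with x h1 h2
  rw [h1, h2]

theorem min_one_edist_triangle (x y z : Y) :
    min 1 (edist x z) ≤ min 1 (edist x y) + min 1 (edist y z) := by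
  rcases le_total 1 (edist x y) with h | h
  · rw [min_eq_left h]
    exact (min_le_left _ _).trans le_self_add
  rcases le_total 1 (edist y z) with h' | h'
  · rw [min_eq_left h']
    exact (min_le_left _ _).trans le_add_self
  rw [min_eq_right h, min_eq_right h']
  exact (min_le_right _ _).trans (edist_triangle _ _ _)

/-- The extended metric of convergence in measure. -/
@[reducible]
noncomputable def emetricInMeasure (μ : Measure X) (Y : Type*) [MetricSpace Y] :
    EMetricSpace (X →ₘ[μ] Y) where
  edist := edistInMeasure
  edist_self f := by simp [edistInMeasure]
  edist_comm f h := by simp [edistInMeasure, edist_comm]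
  edist_triangle f h k := by
    refine (lintegral_mono fun x => min_one_edist_triangle (f x) (h x) (k x)).trans_eq ?_
    exact lintegral_add_left' (aemeasurable_min_edist f h) _
  eq_of_edist_eq_zero {f h} hfh := by
    refine AEEqFun.ext ?_
    filter_upwards [(lintegral_eq_zero_iff' (aemeasurable_min_edist f h)).1 hfh] with x hx
    rcases min_choice 1 (edist (f x) (h x)) with h1 | h1
    · exact absurd (h1.symm.trans hx) one_ne_zero
    · exact edist_eq_zero.1 (h1.symm.trans hx)

theorem tendsto_edistInMeasure [IsFiniteMeasure μ] {f : X →ₘ[μ] Y} {u : ℕ → X →ₘ[μ] Y}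
    (h : ∀ᵐ x ∂μ, Filter.Tendsto (fun n => u n x) Filter.atTop (𝓝 (f x))) :
    Filter.Tendsto (fun n => edistInMeasure (u n) f) Filter.atTop (𝓝 0) := by
  rw [← lintegral_zero (μ := μ)]
  refine tendsto_lintegral_of_dominated_convergence' (fun _ => 1)
    (fun n => aemeasurable_min_edist _ _) (fun n => Filter.Eventually.of_forall fun x => min_le_left _ _)
    (by simp) ?_
  filter_upwards [h] with x hx
  have := (tendsto_iff_edist_tendsto_0.1 hx)
  simpa using (tendsto_const_nhds (x := (1 : ℝ≥0∞))).min this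

/-- For a rapidly Cauchy sequence the truncated distances of consecutive terms have a summable
integral, hence are summable almost everywhere. The sequence therefore converges almost everywhere,
and dominated convergence finishes. -/
theorem completeSpace_inMeasure [IsFiniteMeasure μ] [CompleteSpace Y] :
    @CompleteSpace (X →ₘ[μ] Y) (emetricInMeasure μ Y).toUniformSpace := by
  let := emetricInMeasure μ Y
  refine EMetric.complete_of_convergent_controlled_sequences (fun n => (2 : ℝ≥0∞)⁻¹ ^ n)
    (fun n => ENNReal.pow_pos (by simp) n) fun u hu => ?_
  have hsum : ∫⁻ x, ∑' n, min 1 (edist (u n x) (u (n + 1) x)) ∂μ ≠ ⊤ := by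
    rw [lintegral_tsum fun n => aemeasurable_min_edist _ _]
    refine ne_top_of_le_ne_top ?_ (ENNReal.tsum_le_tsum fun n =>
      (hu n n (n + 1) le_rfl (Nat.le_succ n)).le)
    rw [ENNReal.tsum_geometric]
    simp
  have hcauchy : ∀ᵐ x ∂μ, ∃ y, Filter.Tendsto (fun n => u n x) Filter.atTop (𝓝 y) := by
    filter_upwards [ae_lt_top' (AEMeasurable.tsum fun n => aemeasurable_min_edist _ _) hsum]
      with x hx
    refine cauchySeq_tendsto_of_complete ?_
    have h0 := ENNReal.tendsto_atTop_zero_of_tsum_ne_top hx.ne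
    -- From `N` on the truncated distances are below `1`, so they are the true distances.
    obtain ⟨N, hN⟩ := Filter.eventually_atTop.1 (h0.eventually_lt_const one_pos)
    refine (cauchySeq_shift N).1 ?_
    refine cauchySeq_of_edist_le_of_tsum_ne_top (fun n => min 1 (edist (u (n + N) x) (u (n + N + 1) x)))
      (fun n => ?_) ?_
    · have h1 := hN (n + N) (Nat.le_add_left _ _)
      rw [show n.succ + N = n + N + 1 by omega]
      refine le_min_iff.2 ⟨?_, le_rfl⟩
      by_contra h2
      rw [min_eq_left (not_le.1 h2).le] at h1
      exact lt_irrefl _ h1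
    · exact ne_top_of_le_ne_top hx.ne
        (ENNReal.tsum_comp_le_tsum_of_injective (add_left_injective N)
          fun n => min 1 (edist (u n x) (u (n + 1) x)))
  obtain ⟨f, hf, hlim⟩ := exists_stronglyMeasurable_limit_of_tendsto_ae
    (fun n => (u n).aestronglyMeasurable) hcauchy
  refine ⟨AEEqFun.mk f hf.aestronglyMeasurable, ?_⟩
  rw [tendsto_iff_edist_tendsto_0]
  refine tendsto_edistInMeasure ?_
  filter_upwards [hlim, AEEqFun.coeFn_mk f hf.aestronglyMeasurable] with x h1 h2
  rwa [h2]

/-- The class of a simple function. -/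
noncomputable def simpleClass (μ : Measure X) {Y : Type*} [TopologicalSpace Y]
    (s : SimpleFunc X Y) : X →ₘ[μ] Y :=
  AEEqFun.mk s s.stronglyMeasurable.aestronglyMeasurable

theorem exists_simple_edistInMeasure_lt [IsFiniteMeasure μ] (f : X →ₘ[μ] Y) {ε : ℝ≥0∞}
    (hε : 0 < ε) : ∃ s : SimpleFunc X Y, edistInMeasure (simpleClass μ s) f < ε := by
  have h : Filter.Tendsto (fun n => edistInMeasure (simpleClass μ (f.stronglyMeasurable.approx n)) f)
      Filter.atTop (𝓝 0) := by
    refine tendsto_edistInMeasure ?_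
    have h1 : ∀ᵐ x ∂μ, ∀ n, simpleClass μ (f.stronglyMeasurable.approx n) x
        = f.stronglyMeasurable.approx n x := ae_all_iff.2 fun n => AEEqFun.coeFn_mk _ _
    filter_upwards [h1] with x hx
    simpa only [hx] using f.stronglyMeasurable.tendsto_approx x
  obtain ⟨n, hn⟩ := (h.eventually_lt_const hε).exists
  exact ⟨_, hn⟩

/-- Off `symmDiff s t` both functions use the same branch; on it the integrand is at most `1`. -/
theorem edistInMeasure_piecewise_le {f g f' g' : SimpleFunc X Y} {s t : Set X}
    (hs : MeasurableSet s) (ht : MeasurableSet t) :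
    edistInMeasure (simpleClass μ (f.piecewise s hs g)) (simpleClass μ (f'.piecewise t ht g')) ≤
      μ (symmDiff s t) + (edistInMeasure (simpleClass μ f) (simpleClass μ f') +
        edistInMeasure (simpleClass μ g) (simpleClass μ g')) := by
  simp only [edistInMeasure_eq (AEEqFun.coeFn_mk _ _) (AEEqFun.coeFn_mk _ _), simpleClass]
  have hst : MeasurableSet (symmDiff s t) := hs.symmDiff ht
  have hm (f f' : SimpleFunc X Y) : Measurable fun x => min 1 (edist (f x) (f' x)) :=
    measurable_const.min (continuous_edist.comp_stronglyMeasurable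
      (f.stronglyMeasurable.prodMk f'.stronglyMeasurable)).measurable
  rw [← lintegral_add_left (hm f f'), ← lintegral_indicator_one hst,
    ← lintegral_add_left (measurable_one.indicator hst)]
  refine lintegral_mono fun x => ?_
  classical
  simp only [SimpleFunc.coe_piecewise, Set.piecewise, Set.indicator, Set.mem_symmDiff, Pi.one_apply]
  by_cases h1 : x ∈ s <;> by_cases h2 : x ∈ t <;> simp [h1, h2]

theorem exists_gluedSimple_edistInMeasure_lt [Nonempty Y] {𝒜 : Set {s : Set X // MeasurableSet s}}
    (h𝒜 : μ.MeasureDense (Subtype.val '' 𝒜)) [IsProbabilityMeasure μ] {D : Set Y} (hD : Dense D)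
    (f : SimpleFunc X Y) : ∀ ε : ℝ, 0 < ε → ∃ n, ∃ f' ∈ gluedSimple 𝒜 D n,
      edistInMeasure (simpleClass μ f) (simpleClass μ f') < ENNReal.ofReal ε := by
  induction f using SimpleFunc.induction' with
  | const c =>
    intro ε hε
    obtain ⟨d, hd, hcd⟩ := hD.exists_dist_lt c hε
    refine ⟨0, SimpleFunc.const X d, ⟨d, hd, rfl⟩, ?_⟩
    rw [simpleClass, simpleClass,
      edistInMeasure_eq (AEEqFun.coeFn_mk _ _) (AEEqFun.coeFn_mk _ _)]
    simp only [SimpleFunc.const_apply, lintegral_const, measure_univ, mul_one]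
    refine (min_le_right _ _).trans_lt ?_
    rw [edist_dist]
    exact (ENNReal.ofReal_lt_ofReal_iff hε).2 hcd
  | pcw hs ihf ihg =>
    rename_i f g s
    intro ε hε
    obtain ⟨n₁, f', hf', h1⟩ := ihf (ε / 3) (by positivity)
    obtain ⟨n₂, g', hg', h2⟩ := ihg (ε / 3) (by positivity)
    obtain ⟨_, ⟨t, ht, rfl⟩, h3⟩ := h𝒜.approx s hs (measure_ne_top _ _) (ε / 3) (by positivity)
    -- Both approximations are raised to a common level, and gluing them costs one more round.
    refine ⟨max n₁ n₂ + 1, f'.piecewise t.1 t.2 g', Or.inr (Set.mem_biUnion ht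
      ⟨f', gluedSimple_mono _ _ (le_max_left _ _) hf', g',
        gluedSimple_mono _ _ (le_max_right _ _) hg', rfl⟩), ?_⟩
    refine (edistInMeasure_piecewise_le hs t.2).trans_lt ?_
    have h4 : ε = ε / 3 + (ε / 3 + ε / 3) := by ring
    rw [h4, ENNReal.ofReal_add (by positivity) (by positivity),
      ENNReal.ofReal_add (by positivity) (by positivity)]
    exact ENNReal.add_lt_add h3 (ENNReal.add_lt_add h1 h2)

theorem separableSpace_inMeasure [IsProbabilityMeasure μ] [IsSeparable μ]
    [TopologicalSpace.SeparableSpace Y] [Nonempty Y] :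
    @TopologicalSpace.SeparableSpace (X →ₘ[μ] Y)
      (emetricInMeasure μ Y).toUniformSpace.toTopologicalSpace := by
  let := emetricInMeasure μ Y
  obtain ⟨𝒜, h𝒜c, h𝒜⟩ := exists_countable_measureDense μ
  obtain ⟨D, hDc, hD⟩ := TopologicalSpace.exists_countable_dense Y
  let 𝒜' : Set {s : Set X // MeasurableSet s} := Subtype.val ⁻¹' 𝒜
  have h𝒜' : Subtype.val '' 𝒜' = 𝒜 := by
    refine Set.image_preimage_eq_of_subset ?_
    rw [Subtype.range_coe_subtype]
    exact h𝒜.measurable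
  have h𝒜c' : 𝒜'.Countable := h𝒜c.preimage Subtype.val_injective
  rw [← h𝒜'] at h𝒜
  refine ⟨⋃ n, simpleClass μ '' gluedSimple 𝒜' D n,
    Set.countable_iUnion fun n => (gluedSimple_countable h𝒜c' hDc n).image _, fun f => ?_⟩
  rw [EMetric.mem_closure_iff]
  intro ε hε
  -- `ε` may be infinite, while the approximation by glued functions needs a finite tolerance.
  obtain ⟨δ, hδ, hδε⟩ := ENNReal.lt_iff_exists_nnreal_btwn.1 (ENNReal.half_pos hε.ne')
  have hδ' : (0 : ℝ) < δ := by exact_mod_cast hδ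
  obtain ⟨s, hs⟩ := exists_simple_edistInMeasure_lt f (ENNReal.half_pos hε.ne')
  obtain ⟨n, s', hs', hss'⟩ := exists_gluedSimple_edistInMeasure_lt h𝒜 hD s δ hδ'
  refine ⟨_, Set.mem_iUnion.2 ⟨n, s', hs', rfl⟩, ?_⟩
  refine (edist_triangle_left _ _ (simpleClass μ s)).trans_lt ?_
  rw [← ENNReal.add_halves ε]
  refine ENNReal.add_lt_add hs (LT.lt.trans hss' ?_)
  simpa using hδε

end Metric

end ConvergenceInMeasure

/-! ### The topology of `LZero`: Baire property, countable base, continuity -/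

section LZeroTopology

open ENNReal TopologicalSpace

variable {X : Type*} [MeasurableSpace X] {μ : Measure X} [IsProbabilityMeasure μ]

/-- Markov's inequality at level `min δ 1`; the minimum is needed because the integrand is truncated
at `1`. -/
theorem lt_measureReal_of_edistInMeasure_lt {Y : Type*} [MetricSpace Y] {f h : X →ₘ[μ] Y}
    {δ ε : ℝ} (hδ : 0 < δ) (hfh : edistInMeasure f h < ENNReal.ofReal (min δ 1 * ε)) :
    1 - ε < μ.real {x | dist (f x) (h x) < δ} := by
  have hδ' : 0 < min δ 1 := lt_min hδ one_pos
  have h1 := (mul_meas_ge_le_lintegral₀ (aemeasurable_min_edist f h)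
    (ENNReal.ofReal (min δ 1))).trans_lt hfh
  rw [ENNReal.ofReal_mul hδ'.le] at h1
  have h2 := lt_of_mul_lt_mul_left' h1
  have h3 : μ.real {x | δ ≤ dist (f x) (h x)} < ε := by
    refine ENNReal.toReal_lt_of_lt_ofReal ((measure_mono fun x hx => ?_).trans_lt h2)
    have hx : δ ≤ dist (f x) (h x) := hx
    refine le_min (ENNReal.ofReal_le_one.2 (min_le_right _ _)) ?_
    rw [edist_dist]
    exact ENNReal.ofReal_le_ofReal ((min_le_left _ _).trans hx)
  have h4 : μ.real Set.univ ≤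
      μ.real {x | dist (f x) (h x) < δ} + μ.real {x | δ ≤ dist (f x) (h x)} := by
    refine le_trans (measureReal_mono fun x _ => ?_) (measureReal_union_le _ _)
    exact lt_or_ge (dist (f x) (h x)) δ
  rw [probReal_univ] at h4
  linarith

theorem edistInMeasure_le_of_lt_measureReal {Y : Type*} [MetricSpace Y] {f h : X →ₘ[μ] Y}
    {δ ε : ℝ} (hfh : 1 - ε < μ.real {x | dist (f x) (h x) < δ}) :
    edistInMeasure f h ≤ ENNReal.ofReal δ + ENNReal.ofReal ε := by
  have hm : NullMeasurableSet {x | dist (f x) (h x) < δ} μ :=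
    nullMeasurableSet_lt (continuous_dist.comp_aestronglyMeasurable₂ f.aestronglyMeasurable
      h.aestronglyMeasurable).aemeasurable aemeasurable_const
  have h1 : μ {x | dist (f x) (h x) < δ}ᶜ ≤ ENNReal.ofReal ε := by
    rw [← ofReal_measureReal, probReal_compl_eq_one_sub₀ hm]
    exact ENNReal.ofReal_le_ofReal (by linarith)
  have h2 : edistInMeasure f h ≤ ∫⁻ x, ENNReal.ofReal δ +
      ({x | dist (f x) (h x) < δ}ᶜ : Set X).indicator 1 x ∂μ := by
    refine lintegral_mono fun x => ?_
    by_cases hx : dist (f x) (h x) < δ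
    · refine (min_le_right _ _).trans (le_trans ?_ le_self_add)
      rw [edist_dist]
      exact ENNReal.ofReal_le_ofReal hx.le
    · refine (min_le_left _ _).trans (le_trans ?_ le_add_self)
      rw [Set.indicator_of_mem (by exact hx)]
      exact le_rfl
  rw [lintegral_add_left measurable_const, lintegral_indicator_one₀ hm.compl, lintegral_const,
    measure_univ, mul_one] at h2
  exact h2.trans (by gcongr)

variable {Y : Type*} [TopologicalSpace Y] [IsCompletelyMetrizableSpace Y]

/-- The extended metric on `LZero μ Y` built from a complete metric on `Y`. -/
@[reducible]
noncomputable def LZero.emetric (μ : Measure X) (Y : Type*) [TopologicalSpace Y]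
    [IsCompletelyMetrizableSpace Y] : EMetricSpace (LZero μ Y) :=
  letI := upgradeIsCompletelyMetrizable Y
  emetricInMeasure μ Y

theorem LZero.topology_eq :
    (LZero.topology : TopologicalSpace (LZero μ Y)) =
      (LZero.emetric μ Y).toUniformSpace.toTopologicalSpace := by
  let := upgradeIsCompletelyMetrizable Y
  refine TopologicalSpace.ext_iff.2 fun U => ?_
  rw [@EMetric.isOpen_iff _ (LZero.emetric μ Y).toPseudoEMetricSpace]
  refine forall₂_congr fun h _ => ⟨?_, ?_⟩
  · rintro ⟨δ, hδ, ε, hε, hU⟩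
    refine ⟨ENNReal.ofReal (min δ 1 * ε),
      ENNReal.ofReal_pos.2 (mul_pos (lt_min hδ one_pos) hε), fun f hf => hU ?_⟩
    exact lt_measureReal_of_edistInMeasure_lt hδ hf
  · rintro ⟨r, hr, hU⟩
    obtain ⟨δ, hδ, hδr⟩ := ENNReal.lt_iff_exists_nnreal_btwn.1 (ENNReal.half_pos hr.ne')
    have hδ' : (0 : ℝ) < δ := by exact_mod_cast hδ
    refine ⟨δ, hδ', δ, hδ', fun f hf => hU ?_⟩
    refine (edistInMeasure_le_of_lt_measureReal hf).trans_lt ?_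
    rw [ENNReal.ofReal_coe_nnreal, ← ENNReal.add_halves r]
    exact ENNReal.add_lt_add hδr hδr

/-- The extended metric on `LZero μ Y`, inducing its topology of convergence in measure. -/
@[reducible]
noncomputable def LZero.upgrade (μ : Measure X) [IsProbabilityMeasure μ] (Y : Type*)
    [TopologicalSpace Y] [IsCompletelyMetrizableSpace Y] : EMetricSpace (LZero μ Y) :=
  (LZero.emetric μ Y).replaceTopology LZero.topology_eq

instance LZero.baireSpace : BaireSpace (LZero μ Y) := by
  let e := LZero.upgrade μ Y
  have : CompleteSpace (LZero μ Y) := by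
    have h : @CompleteSpace (LZero μ Y) (LZero.emetric μ Y).toUniformSpace := by
      let := upgradeIsCompletelyMetrizable Y
      exact completeSpace_inMeasure
    have heq : e.toUniformSpace = (LZero.emetric μ Y).toUniformSpace :=
      UniformSpace.replaceTopology_eq (LZero.emetric μ Y).toUniformSpace LZero.topology_eq
    rw [heq]
    exact h
  infer_instance

instance LZero.t2Space : T2Space (LZero μ Y) := by
  let e := LZero.upgrade μ Y
  infer_instance

instance LZero.secondCountableTopology [IsSeparable μ] [SeparableSpace Y] [Nonempty Y] :
    SecondCountableTopology (LZero μ Y) := by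
  let e := LZero.upgrade μ Y
  have : SeparableSpace (LZero μ Y) := by
    let := upgradeIsCompletelyMetrizable Y
    rw [LZero.topology_eq]
    exact separableSpace_inMeasure (μ := μ) (Y := Y)
  exact UniformSpace.secondCountable_of_separable _

/-- A nonempty open set of `LZero μ Y` contains all simple functions that are pointwise close to a
suitable one. -/
theorem LZero.exists_simple {U : Set (LZero μ Y)} (hU : IsOpen U) (hUn : U.Nonempty) :
    ∃ (s : SimpleFunc X Y) (V : Y → Set Y), (∀ y, IsOpen (V y)) ∧ (∀ y, y ∈ V y) ∧
      ∀ s' : SimpleFunc X Y, (∀ x, s' x ∈ V (s x)) → simpleClass μ s' ∈ U := by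
  let := upgradeIsCompletelyMetrizable Y
  obtain ⟨f, hf⟩ := hUn
  rw [LZero.topology_eq, @EMetric.isOpen_iff _ (LZero.emetric μ Y).toPseudoEMetricSpace] at hU
  obtain ⟨r, hr, hrU⟩ := hU f hf
  obtain ⟨δ, hδ, hδr⟩ := exists_between (ENNReal.half_pos hr.ne')
  obtain ⟨s, hs⟩ := exists_simple_edistInMeasure_lt f (ENNReal.half_pos hr.ne')
  refine ⟨s, fun y => Metric.eball y δ, fun y => Metric.isOpen_eball,
    fun y => Metric.mem_eball_self hδ, fun s' hs' => hrU ?_⟩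
  have h1 : edistInMeasure (simpleClass μ s') (simpleClass μ s) ≤ δ := by
    rw [simpleClass, simpleClass,
      edistInMeasure_eq (AEEqFun.coeFn_mk _ _) (AEEqFun.coeFn_mk _ _)]
    calc _ ≤ ∫⁻ _, δ ∂μ := lintegral_mono fun x => (min_le_right _ _).trans (hs' x).le
      _ = δ := by simp
  refine ((LZero.emetric μ Y).edist_triangle _ (simpleClass μ s) _).trans_lt ?_
  rw [← ENNReal.add_halves r]
  exact ENNReal.add_lt_add (h1.trans_lt hδr) hs

/-- `F` need not be uniformly continuous, but for fixed `h` one modulus of continuity works at `h x`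
for all `x` outside a set of small measure. -/
theorem LZero.continuous_comp {Z : Type*} [TopologicalSpace Z] [IsCompletelyMetrizableSpace Z]
    {F : Y → Z} (hF : Continuous F) :
    Continuous (AEEqFun.comp F hF : LZero μ Y → LZero μ Z) := by
  refine ⟨fun U hU h hh => ?_⟩
  obtain ⟨δ, hδ, ε, hε, hsub⟩ := hU _ hh
  let := upgradeIsCompletelyMetrizable Y
  let := upgradeIsCompletelyMetrizable Z
  let : MeasurableSpace Y := borel Y
  have : BorelSpace Y := ⟨rfl⟩
  -- Points near which `F` varies by more than `δ / 2` at scale `1 / (n + 1)`. By continuity these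
  -- decreasing sets have empty intersection, so their preimages under `h` have measure tending to
  -- `0`.
  let B : ℕ → Set Y := fun n => {z | ∃ y, dist y z < 1 / (n + 1) ∧ δ / 2 < dist (F y) (F z)}
  have hBo (n : ℕ) : IsOpen (B n) := by
    have : B n = ⋃ y, {z | dist y z < 1 / (n + 1)} ∩ {z | δ / 2 < dist (F y) (F z)} := by
      ext; simp [B]
    rw [this]
    exact isOpen_iUnion fun y => (isOpen_lt (by fun_prop) (by fun_prop)).inter
      (isOpen_lt (by fun_prop) (by fun_prop))
  have hBanti : Antitone B := by
    rintro m n hmn z ⟨y, h1, h2⟩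
    exact ⟨y, h1.trans_le (one_div_le_one_div_of_le (by positivity) (by gcongr)), h2⟩
  have hBinter : ⋂ n, h ⁻¹' B n = ∅ := by
    rw [← Set.preimage_iInter]
    refine Set.eq_empty_of_forall_notMem fun x hx => ?_
    rw [Set.mem_preimage, Set.mem_iInter] at hx
    obtain ⟨η, hη, hFη⟩ := Metric.continuous_iff.1 hF (h x) (δ / 2) (by positivity)
    obtain ⟨n, hn⟩ := exists_nat_one_div_lt hη
    obtain ⟨y, h1, h2⟩ := hx n
    exact lt_asymm h2 (hFη y (h1.trans hn))
  have hlim := tendsto_measure_iInter_atTop (μ := μ)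
    (fun n => (h.stronglyMeasurable.measurable (hBo n).measurableSet).nullMeasurableSet)
    (fun m n hmn => Set.preimage_mono (hBanti hmn)) ⟨0, measure_ne_top _ _⟩
  rw [hBinter, measure_empty] at hlim
  obtain ⟨n, hn⟩ := (hlim.eventually_lt_const
    (ENNReal.ofReal_pos.2 (half_pos hε))).exists
  have hn : μ.real (h ⁻¹' B n) < ε / 2 := ENNReal.toReal_lt_of_lt_ofReal hn
  refine ⟨1 / (n + 1), by positivity, ε / 2, half_pos hε, fun f hf => hsub ?_⟩
  have hf : 1 - ε / 2 < μ.real {x | dist (f x) (h x) < 1 / (n + 1)} := hf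
  change 1 - ε < μ.real {x | dist (AEEqFun.comp F hF f x) (AEEqFun.comp F hF h x) < δ}
  have hae : {x | dist (AEEqFun.comp F hF f x) (AEEqFun.comp F hF h x) < δ} =ᵐ[μ]
      {x | dist (F (f x)) (F (h x)) < δ} := by
    refine Filter.eventuallyEq_set.2 ?_
    filter_upwards [AEEqFun.coeFn_comp F hF f, AEEqFun.coeFn_comp F hF h] with x h1 h2
    simp [h1, h2]
  rw [measureReal_congr hae]
  have hle : μ.real {x | dist (f x) (h x) < 1 / (n + 1)} ≤
      μ.real {x | dist (F (f x)) (F (h x)) < δ} + μ.real (h ⁻¹' B n) := by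
    refine (measureReal_mono fun x hx => ?_).trans (measureReal_union_le _ _)
    by_cases hxB : h x ∈ B n
    · exact Or.inr hxB
    · refine Or.inl (lt_of_le_of_lt ?_ (half_lt_self hδ))
      by_contra hc
      exact hxB ⟨f x, hx, not_le.1 hc⟩
  linarith

end LZeroTopology

/-! ### Evaluating words in powers and in `LZero` -/

section Words

variable {X : Type*} [MeasurableSpace X] {μ : Measure X}

theorem map_lift_pair {H K : Type*} [Group H] [Group K] (φ : H →* K) (g b : H)
    (w : FreeGroup (Fin 2)) :
    φ (FreeGroup.lift ![g, b] w) = FreeGroup.lift ![φ g, φ b] w := by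
  have : φ.comp (FreeGroup.lift ![g, b]) = FreeGroup.lift ![φ g, φ b] := by
    ext i
    fin_cases i <;> simp
  exact DFunLike.congr_fun this w

/-- Makes conjugation a word map, so that continuity and pointwise evaluation of words cover it too.
-/
theorem conj_eq_lift {H : Type*} [Group H] (g b : H) (l : ℤ) :
    g ^ l * b * g ^ (-l) = FreeGroup.lift ![g, b]
      (FreeGroup.of 0 ^ l * FreeGroup.of 1 * FreeGroup.of 0 ^ (-l)) := by
  simp

/-- Both sides are compared as germs, where words are computed pointwise on representatives. -/
theorem lift_const_eq_comp {H : Type*} [Group H] [TopologicalSpace H] [IsTopologicalGroup H]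
    (g : H) (w : FreeGroup (Fin 2)) (b : LZero μ H) :
    FreeGroup.lift ![AEEqFun.const X g, b] w =
      AEEqFun.comp (fun y => FreeGroup.lift ![g, y] w) (continuous_lift g w) b := by
  refine AEEqFun.toGerm_injective ?_
  have h1 : FreeGroup.lift ![Function.const X g, b] w = fun x => FreeGroup.lift ![g, b x] w :=
    funext fun x => map_lift_pair (Pi.evalMonoidHom (fun _ : X => H) x) _ _ w
  have h2 := map_lift_pair (Filter.Germ.coeMulHom (ae μ) : (X → H) →* _) (Function.const X g) b w
  refine (map_lift_pair (AEEqFun.toGermMonoidHom : LZero μ H →* _) _ b w).trans ?_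
  rw [AEEqFun.comp_toGerm, AEEqFun.toGerm_eq b]
  rw [h1] at h2
  refine Eq.trans ?_ h2.symm
  congr 2
  exact congrArg₂ (fun p q => ![p, q]) (AEEqFun.mk_toGerm _ _) (AEEqFun.toGerm_eq b)

theorem lift_const_simpleClass {H : Type*} [Group H] [TopologicalSpace H] [IsTopologicalGroup H]
    (g : H) (w : FreeGroup (Fin 2)) (s : SimpleFunc X H) :
    FreeGroup.lift ![AEEqFun.const X g, simpleClass μ s] w =
      simpleClass μ (s.map fun y => FreeGroup.lift ![g, y] w) := by
  rw [lift_const_eq_comp, simpleClass, AEEqFun.comp_mk]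
  rfl

theorem lift_const_apply {ι H : Type*} [Group H] (g : H) (b : ι → H) (w : FreeGroup (Fin 2))
    (i : ι) : FreeGroup.lift ![fun _ => g, b] w i = FreeGroup.lift ![g, b i] w :=
  map_lift_pair (Pi.evalMonoidHom (fun _ : ι => H) i) _ _ w

end Words

/-! ### Transitivity and density in powers and in `LZero` -/

section Generation

variable {L : Language} {M : Type*} [L.Structure M] {g : M ≃[L] M}

theorem ConjugatesAmalgamate.transitive_pi (hg : ConjugatesAmalgamate g) {ι : Type*} [Finite ι]
    {U V : Set (ι → (M ≃[L] M))} (hU : IsOpen U) (hV : IsOpen V) (hUn : U.Nonempty)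
    (hVn : V.Nonempty) :
    ∃ l : ℤ, ∃ b ∈ U, (fun _ => g) ^ l * b * (fun _ => g) ^ (-l) ∈ V := by
  obtain ⟨u, hu⟩ := hUn
  obtain ⟨v, hv⟩ := hVn
  obtain ⟨U', hU', hUU'⟩ := isOpen_pi_iff'.1 hU u hu
  obtain ⟨V', hV', hVV'⟩ := isOpen_pi_iff'.1 hV v hv
  obtain ⟨l, b, hb⟩ := hg.transitive U' V' (fun i => (hU' i).1) (fun i => (hV' i).1)
    (fun i => ⟨_, (hU' i).2⟩) (fun i => ⟨_, (hV' i).2⟩)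
  exact ⟨l, b, hUU' fun i _ => (hb i).1, hVV' fun i _ => (hb i).2⟩

variable [Countable M] {X : Type*} [MeasurableSpace X] {μ : Measure X} [IsProbabilityMeasure μ]

theorem ConjugatesAmalgamate.transitive_lZero (hg : ConjugatesAmalgamate g)
    {U V : Set (LZero μ (M ≃[L] M))} (hU : IsOpen U) (hV : IsOpen V) (hUn : U.Nonempty)
    (hVn : V.Nonempty) :
    ∃ l : ℤ, ∃ b ∈ U, AEEqFun.const X g ^ l * b * AEEqFun.const X g ^ (-l) ∈ V := by
  obtain ⟨s, U', hU'o, hU'm, hU'⟩ := LZero.exists_simple hU hUn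
  obtain ⟨t, V', hV'o, hV'm, hV'⟩ := LZero.exists_simple hV hVn
  -- The pair `(s, t)` takes finitely many values, so one exponent `l` serves all of them.
  obtain ⟨l, b, hb⟩ := hg.transitive (ι := (s.pair t).range) (fun i => U' i.1.1)
    (fun i => V' i.1.2) (fun i => hU'o _) (fun i => hV'o _) (fun i => ⟨_, hU'm _⟩)
    (fun i => ⟨_, hV'm _⟩)
  classical
  -- The default `1` is never attained, since `c` is evaluated only on the range of `(s, t)`.
  let c : (M ≃[L] M) × (M ≃[L] M) → (M ≃[L] M) := fun p =>
    if h : p ∈ (s.pair t).range then b ⟨p, h⟩ else 1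
  have hc (x : X) : c (s x, t x) ∈ U' (s x) ∧ g ^ l * c (s x, t x) * g ^ (-l) ∈ V' (t x) := by
    have hx : (s x, t x) ∈ (s.pair t).range := (s.pair t).mem_range_self x
    simp only [c, dif_pos hx]
    exact hb ⟨_, hx⟩
  refine ⟨l, simpleClass μ ((s.pair t).map c), hU' _ fun x => (hc x).1, ?_⟩
  rw [conj_eq_lift, lift_const_simpleClass]
  refine hV' _ fun x => ?_
  simp only [SimpleFunc.map_apply, ← conj_eq_lift]
  exact (hc x).2

/-- Each value of an approximating simple function is perturbed so that the word is nontrivial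
there. The resulting word function differs from `1` at every point, hence is not `1` almost
everywhere. -/
theorem dense_setOf_lift_const_ne_one {w : FreeGroup (Fin 2)}
    (hw : Dense {b : M ≃[L] M | FreeGroup.lift ![g, b] w ≠ 1}) :
    Dense {b : LZero μ (M ≃[L] M) | FreeGroup.lift ![AEEqFun.const X g, b] w ≠ 1} := by
  rw [dense_iff_inter_open]
  intro U hU hUn
  obtain ⟨s, V, hVo, hVm, hV⟩ := LZero.exists_simple hU hUn
  choose c hcV hc using fun y => hw.inter_open_nonempty (V y) (hVo y) ⟨y, hVm y⟩
  refine ⟨simpleClass μ (s.map c), hV _ fun x => hcV _, fun h => ?_⟩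
  rw [lift_const_simpleClass] at h
  have h1 := (AEEqFun.coeFn_mk (μ := μ) _ _).symm.trans
    ((Filter.EventuallyEq.of_eq (congrArg _ h)).trans AEEqFun.coeFn_one)
  obtain ⟨x, hx⟩ := h1.exists
  exact hc _ hx

end Generation

theorem mainTheorem2 {L : Language} {M : Type*} [L.Structure M] [Countable M] [Nonempty M]
    {X : Type*} [MeasurableSpace X] [StandardBorelSpace X]
    (μ : Measure X) [IsProbabilityMeasure μ] [NullSingletonClass μ]
    (hM : L.IsUltrahomogeneous M) (g : M ≃[L] M) (hg : ConjugatesAmalgamate g) :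
    ((∀ n : ℕ, 1 ≤ n → ∃ b : Fin n → (M ≃[L] M), CyclicallyGenerates (fun _ : Fin n => g) b) ∧
      ∃ b : LZero μ (M ≃[L] M), CyclicallyGenerates (AEEqFun.const X g) b) ∧
    (NoAlgebraicity L M → NoCycles g →
      (∀ n : ℕ, 1 ≤ n → ∃ b : Fin n → (M ≃[L] M),
        CyclicallyGenerates (fun _ : Fin n => g) b ∧ GenerateFreeGroup (fun _ : Fin n => g) b) ∧
      ∃ b : LZero μ (M ≃[L] M),
        CyclicallyGenerates (AEEqFun.const X g) b ∧ GenerateFreeGroup (AEEqFun.const X g) b) := by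
  have hpi (n : ℕ) {ι : Type} [Countable ι] (D : ι → Set (Fin n → (M ≃[L] M)))
      (ho : ∀ i, IsOpen (D i)) (hd : ∀ i, Dense (D i)) :=
    exists_cyclicallyGenerates (fun _ : Fin n => g)
      (fun l => (continuous_lift _ _).congr fun b => (conj_eq_lift _ b l).symm)
      (fun U V hU hV => hg.transitive_pi hU hV) D ho hd
  have hcont (w : FreeGroup (Fin 2)) : Continuous fun b : LZero μ (M ≃[L] M) =>
      FreeGroup.lift ![AEEqFun.const X g, b] w := by
    simp only [lift_const_eq_comp]
    exact LZero.continuous_comp _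
  have hL0 {ι : Type} [Countable ι] (D : ι → Set (LZero μ (M ≃[L] M)))
      (ho : ∀ i, IsOpen (D i)) (hd : ∀ i, Dense (D i)) :=
    exists_cyclicallyGenerates (AEEqFun.const X g : LZero μ (M ≃[L] M))
      (fun l => (hcont _).congr fun b => (conj_eq_lift _ b l).symm)
      (fun U V hU hV => hg.transitive_lZero hU hV) D ho hd
  refine ⟨⟨fun n _ => ?_, ?_⟩, fun hna hnc => ⟨fun n hn => ?_, ?_⟩⟩
  -- The empty family imposes no condition beyond cyclic generation.
  · obtain ⟨b, hb, -⟩ := hpi n (fun _ : Empty => ∅) nofun nofun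
    exact ⟨b, hb⟩
  · obtain ⟨b, hb, -⟩ := hL0 (fun _ : Empty => ∅) nofun nofun
    exact ⟨b, hb⟩
  · simp only [generateFreeGroup_iff]
    refine hpi n (fun w : {w : FreeGroup (Fin 2) // w ≠ 1} =>
        {b | FreeGroup.lift ![fun _ : Fin n => g, b] w ≠ 1})
      (fun w => isOpen_ne_fun (continuous_lift _ _) continuous_const) fun w => ?_
    -- A word nontrivial in coordinate `0` is nontrivial in the power, and dense sets pull back to
    -- dense sets along the open evaluation map.
    refine ((dense_setOf_lift_ne_one hna hnc w.2).preimage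
      (isOpenMap_eval (⟨0, hn⟩ : Fin n))).mono
      fun b (hb : FreeGroup.lift ![g, b ⟨0, hn⟩] w.1 ≠ 1) h => hb ?_
    exact (lift_const_apply g b _ _).symm.trans (congrFun h _)
  · simp only [generateFreeGroup_iff]
    exact hL0 (fun w : {w : FreeGroup (Fin 2) // w ≠ 1} =>
        {b | FreeGroup.lift ![AEEqFun.const X g, b] w ≠ 1})
      (fun w => isOpen_ne_fun (hcont _) continuous_const)
      fun w => dense_setOf_lift_const_ne_one (dense_setOf_lift_ne_one hna hnc w.2)
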